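/- A flow on a compact metrizable space $X$ is a continuous map $\mathbb{R}\times X\to X$, $(t,x)\mapsto\phi_t(x)$, with $\phi_0=\mathrm{id}$ and $\phi_{t+s}=\phi_t\circ\phi_s$; it has no fixed points if for every $x$ there is $t$ with $\phi_t(x)\neq x$. A homeomorphism $\pi:X\to Y$ is a weak equivalence from $(X,\phi)$ to $(Y,\psi)$ if it maps orbits of $\phi$ onto orbits of $\psi$ preserving the orientation of time, i.e. for every $x\in X$ there is an increasing bijection $\sigma:\mathbb{R}\to\mathbb{R}$ with $\pi(\phi_t(x))=\psi_{\sigma(t)}(\pi(x))$ for all $t\in\mathbb{R}$. For $\epsilon>0$ and a distance $d$ on $X$, let $\mathrm{part}_\epsilon(X,d)$ be the smallest cardinality of a set $B$ admitting a map $f:X\to B$ such that $f(x)=f(x')$ implies $d(x,x')\le\epsilon$. For a compatible metric $d$ on $X$ put $d^\phi_{[0,r]}(x,x')=\max_{0\le t\le r}d(\phi_t(x),\phi_t(x'))$, and define the topological entropy of the flow by $$\mathrm{h}_{\mathrm{top}}(X,\phi)=\lim_{\epsilon\to0}\lim_{r\to+\infty}\frac{\log\mathrm{part}_\epsilon(X,d^\phi_{[0,r]})}{r}\in[0,+\infty]$$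 (the limits exist, and the value does not depend on the compatible metric $d$). **Theorem.** Let $(X,\phi)$ and $(Y,\psi)$ be flows without fixed points on nonempty compact metrizable spaces, and let $\pi:X\to Y$ be a weak equivalence from $(X,\phi)$ to $(Y,\psi)$. Then there is a unique map $\theta:\mathbb{R}\times X\to\mathbb{R}$ (the induced time change) such that (i) $\psi_{\theta(t,x)}(\pi(x))=\pi(\phi_t(x))$ for all $t\in\mathbb{R}$, $x\in X$; (ii) $\theta(0,x)=0$ and $t\mapsto\theta(t,x)$ is strictly increasing, for all $x\in X$; (iii) $\theta(t'+t,x)=\theta(t',\phi_t(x))+\theta(t,x)$ for all $t,t'\in\mathbb{R}$, $x\in X$; (iv) $\theta$ is continuous on $\mathbb{R}\times X$. The minimum $m=\min_{x\in X}\theta(1,x)$ and the maximum $M=\max_{x\in X}\theta(1,x)$ exist, $0<m\le M<+\infty$, and $$m\cdot\mathrm{h}_{\mathrm{top}}(Y,\psi)\le\mathrm{h}_{\mathrm{top}}(X,\phi)\le M\cdot\mathrm{h}_{\mathrm{top}}(Y,\psi).$$ In particular, $\mathrm{h}_{\mathrm{top}}(X,\phi)=C\cdot\mathrm{h}_{\mathrm{top}}(Y,\psi)$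 for some real number $C>0$. Hence each of the properties of having zero, positive finite, and infinite topological entropy holds for $(X,\phi)$ if and only if it holds for $(Y,\psi)$. -/

import Mathlib

open Filter Set
open scoped ENNReal Topology

namespace FlowEntropy

/-- A flow without fixed points: no point is fixed by all times. -/
def NoFixedPoints {X : Type*} [TopologicalSpace X] (φ : Flow ℝ X) : Prop :=
  ∀ x : X, ∃ t : ℝ, φ t x ≠ x

/-- The homeomorphism `π` is a weak equivalence from `φ` to `ψ`: it maps every orbit of `φ` onto an
orbit of `ψ` preserving the orientation of time, that is, along each orbit it acts through an
increasing bijection `σ` of the time axis (see `IsWeakEquivalence.image_orbit`). -/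
def IsWeakEquivalence {X Y : Type*} [TopologicalSpace X] [TopologicalSpace Y]
    (φ : Flow ℝ X) (ψ : Flow ℝ Y) (π : X ≃ₜ Y) : Prop :=
  ∀ x : X, ∃ σ : ℝ ≃o ℝ, ∀ t : ℝ, π (φ t x) = ψ (σ t) (π x)

theorem IsWeakEquivalence.image_orbit {X Y : Type*} [TopologicalSpace X] [TopologicalSpace Y]
    {φ : Flow ℝ X} {ψ : Flow ℝ Y} {π : X ≃ₜ Y} (h : IsWeakEquivalence φ ψ π) (x : X) :
    π '' φ.orbit x = ψ.orbit (π x) := by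
  obtain ⟨σ, hσ⟩ := h x
  ext y
  rw [Flow.mem_orbit_iff]
  constructor
  · rintro ⟨z, hz, rfl⟩
    obtain ⟨t, rfl⟩ := (Flow.mem_orbit_iff φ).1 hz
    exact ⟨σ t, (hσ t).symm⟩
  · rintro ⟨s, rfl⟩
    exact ⟨φ (σ.symm s) x, φ.mem_orbit x _, by rw [hσ, OrderIso.apply_symm_apply]⟩

/-- `θ` is the time change induced by `π` between `φ` and `ψ`. -/
structure IsTimeChange {X Y : Type*} [TopologicalSpace X] [TopologicalSpace Y]
    (φ : Flow ℝ X) (ψ : Flow ℝ Y) (π : X ≃ₜ Y) (θ : ℝ → X → ℝ) : Prop where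
  intertwines : ∀ (t : ℝ) (x : X), ψ (θ t x) (π x) = π (φ t x)
  map_zero : ∀ x : X, θ 0 x = 0
  strictMono : ∀ x : X, StrictMono fun t : ℝ => θ t x
  cocycle : ∀ (t' t : ℝ) (x : X), θ (t' + t) x = θ t' (φ t x) + θ t x
  continuous : Continuous fun p : ℝ × X => θ p.1 p.2

/-- The smallest cardinality of a set `B` for which there is a map `f : X → B` (between mere sets)
such that `f x = f x'` implies `d x x' ≤ ε`. -/
noncomputable def part {X : Type*} (ε : ℝ) (d : X → X → ℝ) : ℕ :=
  sInf {n : ℕ | ∃ f : X → Fin n, ∀ x x' : X, f x = f x' → d x x' ≤ ε}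

/-- The Bowen metric `max_{t ∈ F} d (φ_t x, φ_t x')` of the flow over a compact set `F` of times. -/
noncomputable def bowenDist {X : Type*} [MetricSpace X] (φ : Flow ℝ X) (F : Set ℝ) (x x' : X) : ℝ :=
  sSup ((fun t : ℝ => dist (φ t x) (φ t x')) '' F)

/-- The topological entropy of a flow on a compact metric space, with values in `[0, ∞]`:
the limit as `ε → 0` of the growth rates `lim_{r → ∞} log (part ε (d^φ_{[0,r]})) / r`.
The rates are nonincreasing in `ε > 0`, so the limit as `ε → 0` is a supremum; the limit in `r`
exists by subadditivity and is written as an upper limit. -/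
noncomputable def topEntropy {X : Type*} [MetricSpace X] (φ : Flow ℝ X) : ℝ≥0∞ :=
  ⨆ (ε : ℝ) (_ : 0 < ε),
    limsup (fun r : ℝ => ENNReal.ofReal (Real.log (part ε (bowenDist φ (Icc 0 r))) / r)) atTop

end FlowEntropy

/-!
A time change between flows without fixed points is rigid because periods are bounded away from `0`
(`NoFixedPoints.exists_pos_forall_period_eq_zero`): two continuous parametrizations of the same
motion differ by a continuous family of periods starting at `0`, hence coincide
(`NoFixedPoints.eq_of_flow_eq`). So the bijections `σ` of a weak equivalence, normalized by
`σ 0 = 0`, form a unique cocycle `θ`. For short times `θ t x` is confined to an interval free of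
periods, where the relation `ψ (θ t x) (π x) = π (φ t x)` determines it; since this relation
is closed, `θ` is continuous (`continuous_of_intertwines`).

For the entropies, points of `X` whose images stay close under `ψ` need not stay close under `φ`,
because the clocks of the two orbits may drift apart. Over a block of any fixed `ψ`-length `L` this
drift is as small as desired, so that one of three symbols per block suffices to record it up to
a bounded small error. This refines a partition of `Y` at Bowen time `J * L` to one of `X` at the
cost of a factor `3 ^ J` (`IsTimeChange.exists_part_le_mul_three_pow`), which changes the exponential
growth rate by `log 3 / L` per unit of `ψ`-time only. Letting `L` grow yields the comparison
`IsTimeChange.topEntropy_le_mul`. The two inequalities of the theorem are this comparison applied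
to the time change of `π.symm` and to that of `π`, with the linear bounds on elapsed times that the
extrema of `θ 1` provide.
-/

namespace FlowEntropy

/-! ### Periods of a flow without fixed points -/

section Periods

variable {X Y : Type*} [TopologicalSpace X] [TopologicalSpace Y]

theorem flow_int_mul_eq_self (φ : Flow ℝ X) {s : ℝ} {x : X} (h : φ s x = x) (n : ℤ) :
    φ (n * s) x = x := by
  have hnat : ∀ n : ℕ, φ (n * s) x = x := by
    intro n
    induction n with
    | zero => simp
    | succ k ih =>
      rw [show ((k + 1 : ℕ) : ℝ) * s = k * s + s by push_cast; ring, φ.map_add, h, ih]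
  obtain ⟨k, rfl | rfl⟩ := n.eq_nat_or_neg
  · exact_mod_cast hnat k
  · have h1 : φ (-(k * s)) (φ (k * s) x) = x := by
      rw [← φ.map_add, neg_add_cancel, φ.map_zero_apply]
    rw [hnat k] at h1
    simpa using h1

/-- On a compact space the nonzero periods of a flow without fixed points are bounded away
from `0`, uniformly over all points. -/
theorem NoFixedPoints.exists_pos_forall_period_eq_zero [CompactSpace X] [T2Space X]
    {φ : Flow ℝ X} (hφ : NoFixedPoints φ) :
    ∃ T > 0, ∀ (x : X) (s : ℝ), |s| ≤ T → φ s x = x → s = 0 := by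
  have key : ∀ᶠ s in 𝓝 (0 : ℝ), ∀ x ∈ (univ : Set X), φ s x = x → s = 0 := by
    refine isCompact_univ.eventually_forall_of_forall_eventually fun x _ => ?_
    obtain ⟨t, ht⟩ := hφ x
    have hopen : IsOpen {p : ℝ × X | φ p.1 p.2 ≠ p.2} :=
      isOpen_ne_fun (φ.continuous continuous_fst continuous_snd) continuous_snd
    have hmem : {p : ℝ × X | φ p.1 p.2 ≠ p.2} ∈ 𝓝 (t, x) := hopen.mem_nhds ht
    rw [nhds_prod_eq, mem_prod_iff] at hmem
    obtain ⟨U, hU, V, hV, hUV⟩ := hmem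
    obtain ⟨η, hη, hball⟩ := Metric.mem_nhds_iff.1 hU
    rw [nhds_prod_eq]
    have hs : Metric.ball (0 : ℝ) η ∈ 𝓝 (0 : ℝ) := Metric.ball_mem_nhds _ hη
    filter_upwards [prod_mem_prod hs hV] with p hp hper
    by_contra hne
    have hlt : |p.1| < η := by simpa [Real.norm_eq_abs] using hp.1
    -- some multiple of a period shorter than `η` lies within `η` of `t`
    have hmul : dist ((⌊t / p.1⌋ : ℝ) * p.1) t < η := by
      have h1 := Int.floor_le (t / p.1)
      have h2 := Int.lt_floor_add_one (t / p.1)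
      have h3 : (⌊t / p.1⌋ : ℝ) * p.1 - t = (⌊t / p.1⌋ - t / p.1) * p.1 := by
        field_simp
      rw [Real.dist_eq, h3, abs_mul]
      have h4 : |(⌊t / p.1⌋ : ℝ) - t / p.1| ≤ 1 := abs_le.2 ⟨by linarith, by linarith⟩
      calc _ ≤ 1 * |p.1| := by gcongr
        _ < η := by linarith
    exact hUV (mk_mem_prod (hball hmul) hp.2) (flow_int_mul_eq_self φ hper _)
  obtain ⟨η, hη, hball⟩ := Metric.eventually_nhds_iff.1 key
  refine ⟨η / 2, half_pos hη, fun x s hs hx => hball ?_ x (mem_univ x) hx⟩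
  rw [Real.dist_eq, sub_zero]
  linarith

/-- A continuous real function starting at `0` that takes a nonzero value takes a value of any
sufficiently small positive absolute value. -/
theorem exists_abs_eq_of_continuous {h : ℝ → ℝ} (hc : Continuous h) (h0 : h 0 = 0) {t δ : ℝ}
    (hδ : 0 ≤ δ) (ht : δ ≤ |h t|) : ∃ s ∈ uIcc 0 t, |h s| = δ := by
  have := intermediate_value_uIcc (a := 0) (b := t) (hc.abs.continuousOn)
  have hmem : δ ∈ uIcc |h 0| |h t| := by
    rw [h0, abs_zero, uIcc_of_le (abs_nonneg _)]
    exact ⟨hδ, ht⟩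
  exact this hmem

/-- Two continuous parametrizations of the same motion along an orbit coincide. -/
theorem NoFixedPoints.eq_of_flow_eq [CompactSpace Y] [T2Space Y] {ψ : Flow ℝ Y}
    (hψ : NoFixedPoints ψ) {f g : ℝ → ℝ} (hf : Continuous f) (hg : Continuous g)
    (h0 : f 0 = g 0) {y : Y} (h : ∀ t, ψ (f t) y = ψ (g t) y) : f = g := by
  obtain ⟨T, hT, hper⟩ := hψ.exists_pos_forall_period_eq_zero
  have hsub : ∀ t, ψ (f t - g t) y = y := fun t => by
    rw [sub_eq_neg_add, ψ.map_add, h, ← ψ.map_add, neg_add_cancel, ψ.map_zero_apply]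
  funext t
  by_contra hne
  have hpos : 0 < |f t - g t| := abs_pos.2 (sub_ne_zero.2 hne)
  obtain ⟨s, -, hs⟩ := exists_abs_eq_of_continuous (h := fun t => f t - g t) (hf.sub hg)
    (by simp [h0]) (t := t) (δ := min T |f t - g t|) (by positivity) (min_le_right _ _)
  have hzero := hper y _ (hs.le.trans (min_le_left _ _)) (hsub s)
  rw [hzero, abs_zero] at hs
  exact (lt_min hT hpos).ne hs

end Periods

/-! ### Existence and uniqueness of the induced time change -/

section TimeChange

variable {X Y : Type*} [TopologicalSpace X] [TopologicalSpace Y]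
  {φ : Flow ℝ X} {ψ : Flow ℝ Y} {π : X ≃ₜ Y}

theorem IsTimeChange.continuous_left {θ : ℝ → X → ℝ} (h : IsTimeChange φ ψ π θ) (x : X) :
    Continuous fun t => θ t x :=
  h.continuous.comp (continuous_id.prodMk continuous_const)

theorem IsTimeChange.continuous_right {θ : ℝ → X → ℝ} (h : IsTimeChange φ ψ π θ) (t : ℝ) :
    Continuous (θ t) :=
  h.continuous.comp (continuous_const.prodMk continuous_id)

theorem IsTimeChange.eq [CompactSpace Y] [T2Space Y] (hψ : NoFixedPoints ψ) {θ θ' : ℝ → X → ℝ}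
    (h : IsTimeChange φ ψ π θ) (h' : IsTimeChange φ ψ π θ') : θ = θ' := by
  funext t x
  refine congrFun (hψ.eq_of_flow_eq (h.continuous_left x) (h'.continuous_left x)
    (by rw [h.map_zero, h'.map_zero]) (y := π x) fun t => ?_) t
  rw [h.intertwines, h'.intertwines]

/-- Inverse weak equivalences have mutually inverse time changes. -/
theorem IsTimeChange.apply_symm_apply [CompactSpace X] [T2Space X] (hφ : NoFixedPoints φ)
    {θ : ℝ → X → ℝ} {ζ : ℝ → Y → ℝ} (h : IsTimeChange φ ψ π θ)
    (h' : IsTimeChange ψ φ π.symm ζ) (t : ℝ) (x : X) : ζ (θ t x) (π x) = t := by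
  refine congrFun (hφ.eq_of_flow_eq (f := fun t => ζ (θ t x) (π x)) (g := fun t => t)
    ((h'.continuous_left (π x)).comp (h.continuous_left x)) continuous_id
    (by simp [h.map_zero, h'.map_zero]) (y := x) fun t => ?_) t
  have := h'.intertwines (θ t x) (π x)
  rwa [h.intertwines, π.symm_apply_apply, π.symm_apply_apply] at this

theorem IsWeakEquivalence.symm (h : IsWeakEquivalence φ ψ π) :
    IsWeakEquivalence ψ φ π.symm := by
  intro y
  obtain ⟨σ, hσ⟩ := h (π.symm y)
  refine ⟨σ.symm, fun s => ?_⟩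
  rw [π.symm_apply_eq, hσ, σ.apply_symm_apply, π.apply_symm_apply]

/-- Over short times the time change is uniformly small: at its first exit from `(-δ, δ)` it
would carry the orbit of `π x` to `ψ (±δ) (π x)`, which is uniformly far from `π x`. -/
theorem eventually_forall_abs_lt [CompactSpace X] [T2Space Y] {θ : ℝ → X → ℝ}
    (hθ : ∀ t x, ψ (θ t x) (π x) = π (φ t x)) (h0 : ∀ x, θ 0 x = 0)
    (hc : ∀ x, Continuous fun t => θ t x) {δ : ℝ} (hδ : 0 < δ)
    (hper : ∀ (y : Y) (s : ℝ), |s| ≤ δ → ψ s y = y → s = 0) :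
    ∃ η > 0, ∀ t x, |t| < η → |θ t x| < δ := by
  have key : ∀ᶠ t in 𝓝 (0 : ℝ), ∀ x ∈ (univ : Set X),
      ψ δ (π x) ≠ π (φ t x) ∧ ψ (-δ) (π x) ≠ π (φ t x) := by
    refine isCompact_univ.eventually_forall_of_forall_eventually fun x _ => ?_
    have hopen : ∀ a : ℝ, IsOpen {p : ℝ × X | ψ a (π p.2) ≠ π (φ p.1 p.2)} := fun a =>
      isOpen_ne_fun (ψ.continuous continuous_const (π.continuous.comp continuous_snd))
        (π.continuous.comp (φ.continuous continuous_fst continuous_snd))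
    have hmem : ∀ a : ℝ, |a| ≤ δ → a ≠ 0 → ψ a (π x) ≠ π (φ 0 x) := fun a ha hne heq => by
      rw [φ.map_zero_apply] at heq
      exact hne (hper _ a ha heq)
    have hev : ∀ a : ℝ, |a| ≤ δ → a ≠ 0 →
        ∀ᶠ p : ℝ × X in 𝓝 (0, x), ψ a (π p.2) ≠ π (φ p.1 p.2) := fun a ha hne =>
      (hopen a).mem_nhds (hmem a ha hne)
    exact (hev δ (abs_of_pos hδ).le hδ.ne').and
      (hev (-δ) (by rw [abs_neg, abs_of_pos hδ]) (neg_ne_zero.2 hδ.ne'))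
  obtain ⟨η, hη, hball⟩ := Metric.eventually_nhds_iff.1 key
  refine ⟨η, hη, fun t x ht => ?_⟩
  by_contra! hge
  obtain ⟨s, hs, habs⟩ := exists_abs_eq_of_continuous (hc x) (h0 x) hδ.le hge
  have hst : |s| ≤ |t| := by simpa using abs_sub_left_of_mem_uIcc hs
  have := hball (y := s) (by rw [Real.dist_eq, sub_zero]; linarith) x (mem_univ x)
  rcases eq_or_eq_neg_of_abs_eq habs with h | h
  · exact this.1 (h ▸ hθ s x)
  · exact this.2 (h ▸ hθ s x)

/-- A cocycle of time changes that is continuous along each orbit is jointly continuous. For short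
times its values stay in a compact interval free of periods, on which they are determined by a
closed condition; the cocycle relation propagates this to all times. -/
theorem continuous_of_intertwines [CompactSpace X] [CompactSpace Y] [T2Space Y]
    (hψ : NoFixedPoints ψ) {θ : ℝ → X → ℝ}
    (hθ : ∀ t x, ψ (θ t x) (π x) = π (φ t x)) (h0 : ∀ x, θ 0 x = 0)
    (hc : ∀ x, Continuous fun t => θ t x)
    (hcoc : ∀ t' t x, θ (t' + t) x = θ t' (φ t x) + θ t x) :
    Continuous fun p : ℝ × X => θ p.1 p.2 := by
  obtain ⟨T, hT, hper⟩ := hψ.exists_pos_forall_period_eq_zero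
  obtain ⟨η, hη, hsmall⟩ := eventually_forall_abs_lt hθ h0 hc (half_pos hT)
    fun y s hs => hper y s (by linarith)
  have hlocal : ∀ t x, |t| < η → ContinuousAt (fun p : ℝ × X => θ p.1 p.2) (t, x) := by
    intro t x ht
    rw [Metric.continuousAt_iff']
    intro ε hε
    have hK : IsCompact (Icc (-(T / 2)) (T / 2) ∩ {s | ε ≤ dist s (θ t x)}) :=
      isCompact_Icc.inter_right (isClosed_le continuous_const (by fun_prop))
    have hne : ∀ᶠ p : ℝ × X in 𝓝 (t, x),
        ∀ s ∈ Icc (-(T / 2)) (T / 2) ∩ {s | ε ≤ dist s (θ t x)},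
          ψ s (π p.2) ≠ π (φ p.1 p.2) := by
      refine hK.eventually_forall_of_forall_eventually fun s hs => ?_
      have hopen : IsOpen {q : (ℝ × X) × ℝ | ψ q.2 (π q.1.2) ≠ π (φ q.1.1 q.1.2)} :=
        isOpen_ne_fun (ψ.continuous (by fun_prop) (by fun_prop))
          (π.continuous.comp (φ.continuous (by fun_prop) (by fun_prop)))
      refine hopen.mem_nhds (x := ((t, x), s)) fun heq => ?_
      replace heq : ψ s (π x) = ψ (θ t x) (π x) := by rw [hθ]; exact heq
      have hfix : ψ (s - θ t x) (π x) = π x := by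
        rw [sub_eq_neg_add, ψ.map_add, heq, ← ψ.map_add, neg_add_cancel, ψ.map_zero_apply]
      have hlt := abs_lt.1 (hsmall t x ht)
      have hz := hper _ _ (abs_le.2 ⟨by linarith [hs.1.1], by linarith [hs.1.2]⟩) hfix
      have hd : ε ≤ dist s (θ t x) := hs.2
      rw [Real.dist_eq, hz, abs_zero] at hd
      linarith
    have hη' : ∀ᶠ p : ℝ × X in 𝓝 (t, x), |p.1| < η :=
      (isOpen_lt (by fun_prop) continuous_const).mem_nhds ht
    filter_upwards [hne, hη'] with p hp hpη
    by_contra! hge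
    have hlt := abs_lt.1 (hsmall p.1 p.2 hpη)
    exact hp _ ⟨⟨hlt.1.le, hlt.2.le⟩, hge⟩ (hθ _ _)
  have hglobal : ∀ (n : ℕ) t x, |t| < 2 ^ n * η →
      ContinuousAt (fun p : ℝ × X => θ p.1 p.2) (t, x) := by
    intro n
    induction n with
    | zero => intro t x ht; exact hlocal t x (by simpa using ht)
    | succ n ih =>
      intro t x ht
      have ht2 : |t / 2| < 2 ^ n * η := by
        rw [abs_div, abs_two, div_lt_iff₀ two_pos]
        calc |t| < 2 ^ (n + 1) * η := ht
          _ = _ := by ring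
      have hsplit : (fun p : ℝ × X => θ p.1 p.2) =
          fun p => θ (p.1 / 2) (φ (p.1 / 2) p.2) + θ (p.1 / 2) p.2 := by
        funext p
        rw [← hcoc, add_halves]
      rw [hsplit]
      have hc1 : Continuous fun p : ℝ × X => (p.1 / 2, φ (p.1 / 2) p.2) :=
        (by fun_prop : Continuous fun p : ℝ × X => p.1 / 2).prodMk
          (φ.continuous (by fun_prop) (by fun_prop))
      have hc2 : Continuous fun p : ℝ × X => (p.1 / 2, p.2) := by fun_prop
      exact (ContinuousAt.comp (g := fun p : ℝ × X => θ p.1 p.2) (x := (t, x))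
        (ih _ _ ht2) hc1.continuousAt).add
        (ContinuousAt.comp (g := fun p : ℝ × X => θ p.1 p.2) (x := (t, x))
          (ih _ _ ht2) hc2.continuousAt)
  refine continuous_iff_continuousAt.2 fun ⟨t, x⟩ => ?_
  obtain ⟨n, hn⟩ := pow_unbounded_of_one_lt (|t| / η) one_lt_two
  exact hglobal n t x ((div_lt_iff₀ hη).1 hn)

theorem IsWeakEquivalence.exists_isTimeChange [CompactSpace X] [CompactSpace Y] [T2Space Y]
    (hψ : NoFixedPoints ψ) (h : IsWeakEquivalence φ ψ π) : ∃ θ, IsTimeChange φ ψ π θ := by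
  choose σ hσ using h
  set θ : ℝ → X → ℝ := fun t x => σ x t - σ x 0 with hdef
  have hσ0 : ∀ x, ψ (-σ x 0) (π x) = π x := fun x => by
    have h1 : π x = ψ (σ x 0) (π x) := by simpa using hσ x 0
    conv_lhs => rw [h1]
    rw [← ψ.map_add, neg_add_cancel, ψ.map_zero_apply]
  have hθ : ∀ t x, ψ (θ t x) (π x) = π (φ t x) := fun t x => by
    simp only [hdef]
    rw [sub_eq_add_neg, ψ.map_add, hσ0, hσ]
  have h0 : ∀ x, θ 0 x = 0 := fun x => sub_self _
  have hc : ∀ x, Continuous fun t => θ t x := fun x => (σ x).continuous.sub continuous_const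
  have hcoc : ∀ t' t x, θ (t' + t) x = θ t' (φ t x) + θ t x := by
    intro t' t x
    refine congrFun (hψ.eq_of_flow_eq (f := fun t' => θ (t' + t) x)
      (g := fun t' => θ t' (φ t x) + θ t x) ((hc x).comp (continuous_id.add continuous_const))
      ((hc _).add continuous_const) (by simp [h0]) (y := π x) fun t' => ?_) t'
    rw [ψ.map_add, hθ, hθ, hθ, φ.map_add]
  exact ⟨θ, hθ, h0, fun x a b hab => sub_lt_sub_right ((σ x).strictMono hab) _, hcoc,
    continuous_of_intertwines hψ hθ h0 hc hcoc⟩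

/-- A lower bound for a time change over unit times gives a linear lower bound. -/
theorem IsTimeChange.nat_mul_le {θ : ℝ → X → ℝ} (h : IsTimeChange φ ψ π θ) {m : ℝ}
    (hm : ∀ x, m ≤ θ 1 x) (n : ℕ) (x : X) : n * m ≤ θ n x := by
  induction n generalizing x with
  | zero => simp [h.map_zero]
  | succ k ih =>
    push_cast
    rw [h.cocycle]
    linarith [ih (φ 1 x), hm x]

theorem IsTimeChange.le_nat_mul {θ : ℝ → X → ℝ} (h : IsTimeChange φ ψ π θ) {M : ℝ}
    (hM : ∀ x, θ 1 x ≤ M) (n : ℕ) (x : X) : θ n x ≤ n * M := by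
  induction n generalizing x with
  | zero => simp [h.map_zero]
  | succ k ih =>
    push_cast
    rw [h.cocycle]
    linarith [ih (φ 1 x), hM x]

end TimeChange

/-! ### Partitions at a given scale of the Bowen metrics -/

section Partitions

theorem part_le_card {X ι : Type*} [Fintype ι] {ε : ℝ} {d : X → X → ℝ} (f : X → ι)
    (h : ∀ x x', f x = f x' → d x x' ≤ ε) : part ε d ≤ Fintype.card ι :=
  Nat.sInf_le ⟨fun x => Fintype.equivFin ι (f x), fun x x' hxx' =>
    h x x' ((Fintype.equivFin ι).injective hxx')⟩

variable {X : Type*} [MetricSpace X] {φ : Flow ℝ X}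

theorem bowenDist_le {F : Set ℝ} {x x' : X} {ε : ℝ} (hε : 0 ≤ ε)
    (h : ∀ t ∈ F, dist (φ t x) (φ t x') ≤ ε) : bowenDist φ F x x' ≤ ε :=
  Real.sSup_le (by rintro _ ⟨t, ht, rfl⟩; exact h t ht) hε

theorem dist_le_bowenDist [CompactSpace X] {F : Set ℝ} {t : ℝ} (ht : t ∈ F) (x x' : X) :
    dist (φ t x) (φ t x') ≤ bowenDist φ F x x' := by
  refine le_csSup ⟨Metric.diam (univ : Set X), ?_⟩ (mem_image_of_mem _ ht)
  rintro _ ⟨s, -, rfl⟩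
  exact Metric.dist_le_diam_of_mem isCompact_univ.isBounded (mem_univ _) (mem_univ _)

/-- By compactness finite partitions of small Bowen diameter exist, so that the infimum defining
`part` is attained. -/
theorem exists_partition_bowenDist [CompactSpace X] (φ : Flow ℝ X) {ε : ℝ} (hε : 0 < ε)
    {F : Set ℝ} (hF : IsCompact F) :
    ∃ f : X → Fin (part ε (bowenDist φ F)), ∀ x x', f x = f x' → bowenDist φ F x x' ≤ ε := by
  refine Nat.sInf_mem (s := {n : ℕ | ∃ f : X → Fin n, ∀ x x', f x = f x' →
    bowenDist φ F x x' ≤ ε}) ?_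
  have hU : ∀ x : X, {x' | ∀ t ∈ F, dist (φ t x') (φ t x) < ε / 2} ∈ 𝓝 x := fun x => by
    refine hF.eventually_forall_of_forall_eventually fun t _ => ?_
    have hopen : IsOpen {p : X × ℝ | dist (φ p.2 p.1) (φ p.2 x) < ε / 2} :=
      isOpen_lt (by fun_prop) continuous_const
    exact hopen.mem_nhds (by simpa using half_pos hε)
  obtain ⟨s, hs⟩ := CompactSpace.elim_nhds_subcover _ hU
  have hcov : ∀ x : X, ∃ c : s, ∀ t ∈ F, dist (φ t x) (φ t c) < ε / 2 := fun x => by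
    have hx : x ∈ ⋃ c ∈ s, {x' | ∀ t ∈ F, dist (φ t x') (φ t c) < ε / 2} := by
      rw [hs]; trivial
    obtain ⟨c, hc, hx⟩ := mem_iUnion₂.1 hx
    exact ⟨⟨c, hc⟩, hx⟩
  choose f hf using hcov
  refine ⟨_, fun x => Fintype.equivFin s (f x), fun x x' hxx' => bowenDist_le hε.le fun t ht => ?_⟩
  have heq : f x = f x' := (Fintype.equivFin s).injective hxx'
  have h1 := hf x t ht
  have h2 := hf x' t ht
  rw [← heq, dist_comm] at h2
  linarith [dist_triangle (φ t x) (φ t (f x)) (φ t x')]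

theorem one_le_part_bowenDist [CompactSpace X] [Nonempty X] (φ : Flow ℝ X) {ε : ℝ} (hε : 0 < ε)
    {F : Set ℝ} (hF : IsCompact F) : 1 ≤ part ε (bowenDist φ F) := by
  obtain ⟨f, -⟩ := exists_partition_bowenDist φ hε hF
  exact (f (Classical.arbitrary X)).pos

end Partitions

/-! ### Comparing partitions along a time change -/

section Comparison

theorem floor_sub_floor_mem_Icc {a b : ℝ} (h : |a - b| ≤ 1) :
    ⌊a⌋ - ⌊b⌋ ∈ Finset.Icc (-1 : ℤ) 1 := by
  obtain ⟨h1, h2⟩ := abs_le.1 h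
  have ha : ⌊a⌋ ≤ ⌊b⌋ + 1 := by
    rw [← Int.floor_add_one]; exact Int.floor_le_floor (by linarith)
  have hb : ⌊b⌋ ≤ ⌊a⌋ + 1 := by
    rw [← Int.floor_add_one]; exact Int.floor_le_floor (by linarith)
  rw [Finset.mem_Icc]
  omega

variable {X Y : Type*} [MetricSpace X] [CompactSpace X] [MetricSpace Y] [CompactSpace Y]
  {φ : Flow ℝ X} {ψ : Flow ℝ Y} {π : X ≃ₜ Y}

theorem exists_pos_forall_dist_flow_le (φ : Flow ℝ X) {ε : ℝ} (hε : 0 < ε) :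
    ∃ γ > 0, ∀ a, |a| ≤ γ → ∀ x, dist (φ a x) x ≤ ε := by
  have key : ∀ᶠ a in 𝓝 (0 : ℝ), ∀ x ∈ (univ : Set X), dist (φ a x) x < ε := by
    refine isCompact_univ.eventually_forall_of_forall_eventually fun x _ => ?_
    have hopen : IsOpen {p : ℝ × X | dist (φ p.1 p.2) p.2 < ε} :=
      isOpen_lt (by fun_prop) continuous_const
    exact hopen.mem_nhds (by simpa using hε)
  obtain ⟨η, hη, hball⟩ := Metric.eventually_nhds_iff.1 key
  refine ⟨η / 2, half_pos hη, fun a ha x => (hball ?_ x (mem_univ x)).le⟩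
  rw [Real.dist_eq, sub_zero]
  linarith

omit [CompactSpace X] in
theorem IsTimeChange.exists_forall_abs_sub_le {ζ : ℝ → Y → ℝ} (hζ : IsTimeChange ψ φ π.symm ζ)
    (L : ℝ) {γ : ℝ} (hγ : 0 < γ) :
    ∃ δ > 0, ∀ y y', dist y y' < δ → ∀ s ∈ Icc 0 L, |ζ s y - ζ s y'| ≤ γ := by
  have hu := ((isCompact_Icc (a := (0 : ℝ)) (b := L)).prod
    (isCompact_univ (X := Y))).uniformContinuousOn_of_continuous hζ.continuous.continuousOn
  obtain ⟨δ, hδ, h⟩ := Metric.uniformContinuousOn_iff.1 hu γ hγ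
  refine ⟨δ, hδ, fun y y' hy s hs => ?_⟩
  have := h (s, y) ⟨hs, mem_univ _⟩ (s, y') ⟨hs, mem_univ _⟩ (by
    rw [Prod.dist_eq, dist_self]
    exact max_lt hδ hy)
  rw [Real.dist_eq] at this
  exact this.le

/-- A partition of `Y` of small Bowen diameter over `[0, J L]` becomes, after each class is split
into at most `3 ^ J` parts, a partition of `X` of small Bowen diameter over the corresponding
`φ`-times. Within a class the time elapsed for `φ` drifts, relative to a reference point of
the class, by at most `γ` over each block of length `L`; the rounded drift therefore changes by
`-1`, `0` or `1` from one block to the next, and recording these changes synchronizes the orbits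
up to an error of `2 * γ`. -/
theorem IsTimeChange.exists_part_le_mul_three_pow [Nonempty Y] {ζ : ℝ → Y → ℝ}
    (hζ : IsTimeChange ψ φ π.symm ζ) {ε L : ℝ} (hε : 0 < ε) (hL : 0 < L) :
    ∃ ε' > 0, ∀ (r : ℝ) (J : ℕ),
      (∀ x, ∀ t ∈ Icc 0 r, ∃ s ∈ Icc 0 (J * L), ζ s (π x) = t) →
      part ε (bowenDist φ (Icc 0 r)) ≤ part ε' (bowenDist ψ (Icc 0 (J * L))) * 3 ^ J := by
  obtain ⟨γ', hγ', hφγ⟩ := exists_pos_forall_dist_flow_le φ (half_pos hε)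
  obtain ⟨γ, hγ, hγγ'⟩ : ∃ γ > 0, γ + γ = γ' := ⟨γ' / 2, half_pos hγ', add_halves _⟩
  obtain ⟨ε₁, hε₁, hπ⟩ := Metric.uniformContinuous_iff.1
    (CompactSpace.uniformContinuous_of_continuous π.symm.continuous) (ε / 2) (half_pos hε)
  obtain ⟨ε₂, hε₂, hζu⟩ := hζ.exists_forall_abs_sub_le L hγ
  refine ⟨min ε₁ ε₂ / 2, half_pos (lt_min hε₁ hε₂), fun r J hr => ?_⟩
  set ε' := min ε₁ ε₂ / 2 with hε'
  have hε'0 : 0 < ε' := half_pos (lt_min hε₁ hε₂)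
  have hε'1 : ε' < ε₁ := (half_lt_self (lt_min hε₁ hε₂)).trans_le (min_le_left _ _)
  have hε'2 : ε' < ε₂ := (half_lt_self (lt_min hε₁ hε₂)).trans_le (min_le_right _ _)
  obtain ⟨f, hf⟩ := exists_partition_bowenDist ψ hε'0 (isCompact_Icc (a := (0 : ℝ)) (b := J * L))
  have hclose : ∀ y y', f y = f y' → ∀ s ∈ Icc 0 (J * L), dist (ψ s y) (ψ s y') ≤ ε' :=
    fun y y' hy s hs => (dist_le_bowenDist hs y y').trans (hf y y' hy)
  have hblock : ∀ j : ℕ, j ≤ J → (j * L : ℝ) ∈ Icc 0 (J * L) := fun j hj =>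
    ⟨by positivity, by gcongr⟩
  have hincr : ∀ y y', f y = f y' → ∀ j : ℕ, j ≤ J → ∀ u ∈ Icc 0 L,
      |ζ u (ψ (j * L) y) - ζ u (ψ (j * L) y')| ≤ γ := fun y y' hy j hj u hu =>
    hζu _ _ ((hclose y y' hy _ (hblock j hj)).trans_lt hε'2) u hu
  set rep : Y → Y := fun y => Function.invFun f (f y) with hrepdef
  have hrep : ∀ y, f (rep y) = f y := fun y => Function.invFun_eq ⟨y, rfl⟩
  set D : X → ℕ → ℝ := fun x j => ζ (j * L) (π x) - ζ (j * L) (rep (π x)) with hD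
  set k : X → ℕ → ℤ := fun x j => ⌊D x j / γ⌋ with hk
  have hk0 : ∀ x, k x 0 = 0 := fun x => by simp [hk, hD, hζ.map_zero]
  have hstep : ∀ x (j : Fin J), k x (j + 1) - k x j ∈ Finset.Icc (-1 : ℤ) 1 := by
    intro x j
    refine floor_sub_floor_mem_Icc ?_
    rw [← sub_div, abs_div, abs_of_pos hγ, div_le_one hγ]
    have hsucc : ∀ y, ζ ((j + 1 : ℕ) * L) y = ζ L (ψ (j * L) y) + ζ (j * L) y := fun y => by
      rw [← hζ.cocycle]; congr 1; push_cast; ring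
    have hdrift : D x (j + 1) - D x j =
        ζ L (ψ (j * L) (π x)) - ζ L (ψ (j * L) (rep (π x))) := by
      simp only [hD, hsucc]; ring
    rw [hdrift]
    exact hincr _ _ (hrep _).symm _ j.2.le _ ⟨hL.le, le_rfl⟩
  have hcard : Fintype.card (Fin (part ε' (bowenDist ψ (Icc 0 (J * L)))) ×
      (Fin J → Finset.Icc (-1 : ℤ) 1)) = part ε' (bowenDist ψ (Icc 0 (J * L))) * 3 ^ J := by
    simp
  rw [← hcard]
  refine part_le_card (fun x => (f (π x), fun j => ⟨k x (j + 1) - k x j, hstep x j⟩))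
    fun x x' hcode => bowenDist_le hε.le fun t ht => ?_
  obtain ⟨hfeq, hkeq⟩ := Prod.mk.inj hcode
  have hksame : ∀ j : ℕ, j ≤ J → k x j = k x' j := by
    intro j
    induction j with
    | zero => intro _; rw [hk0, hk0]
    | succ i ih =>
      intro hi
      have h1 := Subtype.mk.inj (congrFun hkeq ⟨i, hi⟩)
      have h2 := ih (Nat.le_of_succ_le hi)
      simp only at h1
      omega
  have hsync : ∀ j : ℕ, j ≤ J → |ζ (j * L) (π x) - ζ (j * L) (π x')| ≤ γ := by
    intro j hj
    have h1 := Int.abs_sub_lt_one_of_floor_eq_floor (hksame j hj)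
    rw [← sub_div, abs_div, abs_of_pos hγ, div_lt_one hγ] at h1
    have h2 : D x j - D x' j = ζ (j * L) (π x) - ζ (j * L) (π x') := by
      simp only [hD, hrepdef, hfeq]; ring
    rw [← h2]
    exact h1.le
  obtain ⟨s, hs, hst⟩ := hr x t ht
  have hζs : |ζ s (π x) - ζ s (π x')| ≤ γ' := by
    have hj : ⌊s / L⌋₊ ≤ J := Nat.floor_le_of_le ((div_le_iff₀ hL).2 hs.2)
    have hlow : (⌊s / L⌋₊ : ℝ) * L ≤ s :=
      (le_div_iff₀ hL).1 (Nat.floor_le (div_nonneg hs.1 hL.le))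
    have hup : s ≤ (⌊s / L⌋₊ : ℝ) * L + L := by
      have := (div_lt_iff₀ hL).1 (Nat.lt_floor_add_one (s / L))
      linarith
    have hsplit : ∀ y, ζ s y = ζ (s - ⌊s / L⌋₊ * L) (ψ (⌊s / L⌋₊ * L) y) +
        ζ (⌊s / L⌋₊ * L) y := fun y => by
      rw [← hζ.cocycle, sub_add_cancel]
    rw [hsplit, hsplit, add_sub_add_comm, ← hγγ']
    exact (abs_add_le _ _).trans (add_le_add
      (hincr _ _ hfeq _ hj _ ⟨by linarith, by linarith⟩) (hsync _ hj))
  have hφζ : ∀ x, φ (ζ s (π x)) x = π.symm (ψ s (π x)) := fun x => by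
    rw [← hζ.intertwines, π.symm_apply_apply]
  have h1 : dist (φ t x) (φ (ζ s (π x')) x') ≤ ε / 2 := by
    rw [← hst, hφζ, hφζ]
    exact (hπ ((hclose _ _ hfeq s hs).trans_lt hε'1)).le
  have h2 : dist (φ (ζ s (π x')) x') (φ t x') ≤ ε / 2 := by
    have h3 := hφγ (ζ s (π x') - t) (by rw [← hst, abs_sub_comm]; exact hζs) (φ t x')
    rwa [← φ.map_add, sub_add_cancel] at h3
  linarith [dist_triangle (φ t x) (φ (ζ s (π x')) x') (φ t x')]

end Comparison

/-! ### Comparing entropies -/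

section Entropy

variable {X Y : Type*} [MetricSpace X] [CompactSpace X] [MetricSpace Y] [CompactSpace Y]
  {φ : Flow ℝ X} {ψ : Flow ℝ Y} {π : X ≃ₜ Y}

/-- If every orbit segment of `φ` of length `t` lies in an orbit segment of `ψ` of length at most
`M t + c`, then the entropy of `φ` is at most `M` times that of `ψ`. The factors `3 ^ J` of the
partition bound contribute `M log 3 / L` to the growth rate, which vanishes as the block length `L`
grows. -/
theorem IsTimeChange.topEntropy_le_mul [Nonempty Y] {ζ : ℝ → Y → ℝ}
    (hζ : IsTimeChange ψ φ π.symm ζ) {M c : ℝ} (hM : 0 < M) (hc : 0 ≤ c)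
    (hreach : ∀ x t, 0 ≤ t → ∃ s ∈ Icc 0 (M * t + c), ζ s (π x) = t) :
    topEntropy φ ≤ ENNReal.ofReal M * topEntropy ψ := by
  rcases eq_or_ne (topEntropy ψ) ⊤ with htop | htop
  · rw [htop, ENNReal.mul_top (by simpa using hM)]
    exact le_top
  refine iSup₂_le fun ε hε => ?_
  set b := (topEntropy ψ).toReal with hb
  have hb0 : 0 ≤ b := ENNReal.toReal_nonneg
  have hbound : ∀ η : ℝ, 0 < η →
      limsup (fun r : ℝ => ENNReal.ofReal (Real.log (part ε (bowenDist φ (Icc 0 r))) / r)) atTop ≤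
        ENNReal.ofReal (M * b + (2 * M + 1) * η) := by
    intro η hη
    have hlog3 : 0 < Real.log 3 := Real.log_pos (by norm_num)
    -- with this block length, each factor `3` costs `η * L`
    set L := Real.log 3 / η with hL
    have hL0 : 0 < L := div_pos hlog3 hη
    have hL3 : Real.log 3 = η * L := by rw [hL]; field_simp
    obtain ⟨ε', hε', hpart⟩ := hζ.exists_part_le_mul_three_pow hε hL0
    have hψlt : limsup (fun r : ℝ =>
        ENNReal.ofReal (Real.log (part ε' (bowenDist ψ (Icc 0 r))) / r)) atTop <
          ENNReal.ofReal (b + η) := by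
      refine (le_iSup₂ (f := fun (ε : ℝ) (_ : 0 < ε) => limsup (fun r : ℝ =>
        ENNReal.ofReal (Real.log (part ε (bowenDist ψ (Icc 0 r))) / r)) atTop) ε' hε').trans_lt ?_
      change topEntropy ψ < _
      rw [← ENNReal.ofReal_toReal htop]
      exact (ENNReal.ofReal_lt_ofReal_iff (by positivity)).2 (by linarith)
    have hJ : Tendsto (fun r : ℝ => (⌈(M * r + c) / L⌉₊ : ℝ) * L) atTop atTop := by
      refine tendsto_atTop_mono (f := fun r => M * r + c) (fun r => ?_)
        (tendsto_atTop_add_const_right _ _ (tendsto_id.const_mul_atTop hM))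
      exact (div_le_iff₀ hL0).1 (Nat.le_ceil _)
    have hrem : Tendsto (fun r : ℝ => (b + 2 * η) * (c + L) / r) atTop (𝓝 0) :=
      tendsto_const_nhds.div_atTop tendsto_id
    refine limsup_le_of_le (h := ?_)
    filter_upwards [hJ.eventually (eventually_lt_of_limsup_lt hψlt), eventually_gt_atTop 0,
      hrem.eventually (gt_mem_nhds hη)] with r hr hr0 hrη
    refine ENNReal.ofReal_le_ofReal ?_
    set J := ⌈(M * r + c) / L⌉₊ with hJdef
    have hJlow : M * r + c ≤ J * L := (div_le_iff₀ hL0).1 (Nat.le_ceil _)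
    have hJup : J * L ≤ M * r + c + L := by
      have h1 := (Nat.ceil_lt_add_one (a := (M * r + c) / L) (by positivity)).le
      calc (J : ℝ) * L ≤ ((M * r + c) / L + 1) * L := by gcongr
        _ = M * r + c + L := by field_simp
    have hJ0 : 0 < J * L := lt_of_lt_of_le (by positivity) hJlow
    have hN : Real.log (part ε' (bowenDist ψ (Icc 0 (J * L)))) ≤ (b + η) * (J * L) := by
      rw [← div_le_iff₀ hJ0]
      exact (ENNReal.ofReal_le_ofReal_iff (by positivity)).1 hr.le
    have hle := hpart r J fun x t ht => by
      obtain ⟨s, hs, hst⟩ := hreach x t ht.1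
      refine ⟨s, ⟨hs.1, hs.2.trans (le_trans ?_ hJlow)⟩, hst⟩
      have := mul_le_mul_of_nonneg_left ht.2 hM.le
      linarith
    have hone := one_le_part_bowenDist ψ hε' (isCompact_Icc (a := (0 : ℝ)) (b := J * L))
    have hlog : Real.log (part ε (bowenDist φ (Icc 0 r))) ≤
        Real.log (part ε' (bowenDist ψ (Icc 0 (J * L)))) + J * Real.log 3 := by
      rw [← Real.log_pow, ← Real.log_mul (by positivity) (by positivity)]
      have hcast : (part ε (bowenDist φ (Icc 0 r)) : ℝ) ≤
          part ε' (bowenDist ψ (Icc 0 (J * L))) * 3 ^ J := by exact_mod_cast hle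
      rcases Nat.eq_zero_or_pos (part ε (bowenDist φ (Icc 0 r))) with h0 | h0
      · rw [h0, Nat.cast_zero, Real.log_zero]
        refine Real.log_nonneg ?_
        exact_mod_cast Nat.mul_pos hone (pow_pos three_pos J)
      · exact Real.log_le_log (by exact_mod_cast h0) hcast
    have hfinal : Real.log (part ε (bowenDist φ (Icc 0 r))) ≤
        (b + 2 * η) * (M * r + c + L) := by
      calc _ ≤ (b + η) * (J * L) + J * (η * L) := by rw [← hL3]; linarith
        _ = (b + 2 * η) * (J * L) := by ring
        _ ≤ _ := by gcongr
    calc _ ≤ (b + 2 * η) * (M * r + c + L) / r := by gcongr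
      _ = (b + 2 * η) * M + (b + 2 * η) * (c + L) / r := by field_simp; ring
      _ ≤ M * b + (2 * M + 1) * η := by linarith
  have hlim : Tendsto (fun η : ℝ => ENNReal.ofReal (M * b + (2 * M + 1) * η)) (𝓝[>] 0)
      (𝓝 (ENNReal.ofReal (M * b + (2 * M + 1) * 0))) :=
    ((ENNReal.continuous_ofReal.comp (by fun_prop :
      Continuous fun η : ℝ => M * b + (2 * M + 1) * η)).tendsto 0).mono_left nhdsWithin_le_nhds
  have := ge_of_tendsto hlim (eventually_mem_nhdsWithin.mono fun η hη => hbound η hη)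
  rwa [mul_zero, add_zero, ENNReal.ofReal_mul hM.le, hb, ENNReal.ofReal_toReal htop] at this

/-- A time change that advances by at least `m` in unit time bounds the entropies from below:
by the intermediate value theorem `ψ`-time `s` is reached within `φ`-time `s / m + 1`. -/
theorem IsTimeChange.ofReal_mul_topEntropy_le [Nonempty X] {θ : ℝ → X → ℝ}
    (hθ : IsTimeChange φ ψ π θ) {m : ℝ} (hm0 : 0 < m) (hm : ∀ x, m ≤ θ 1 x) :
    ENNReal.ofReal m * topEntropy ψ ≤ topEntropy φ := by
  have hle : topEntropy ψ ≤ ENNReal.ofReal m⁻¹ * topEntropy φ := by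
    refine IsTimeChange.topEntropy_le_mul (π := π.symm) (ζ := θ) hθ
      (inv_pos.2 hm0) zero_le_one fun y s hs => ?_
    have hceil : s ≤ θ ⌈s / m⌉₊ (π.symm y) :=
      ((div_le_iff₀ hm0).1 (Nat.le_ceil _)).trans (hθ.nat_mul_le hm _ _)
    obtain ⟨t, ht, hts⟩ := intermediate_value_Icc (Nat.cast_nonneg ⌈s / m⌉₊)
      (hθ.continuous_left (π.symm y)).continuousOn ⟨(hθ.map_zero _).trans_le hs, hceil⟩
    refine ⟨t, ⟨ht.1, ht.2.trans ?_⟩, hts⟩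
    have := (Nat.ceil_lt_add_one (a := s / m) (by positivity)).le
    rwa [div_eq_inv_mul] at this ⊢
  calc _ ≤ ENNReal.ofReal m * (ENNReal.ofReal m⁻¹ * topEntropy φ) := by gcongr
    _ = topEntropy φ := by
      rw [← mul_assoc, ← ENNReal.ofReal_mul hm0.le, mul_inv_cancel₀ hm0.ne', ENNReal.ofReal_one,
        one_mul]

/-- A time change that advances by at most `M` in unit time bounds the entropies from above. -/
theorem IsTimeChange.topEntropy_le_ofReal_mul [Nonempty X] (hφ : NoFixedPoints φ)
    {θ : ℝ → X → ℝ} {ζ : ℝ → Y → ℝ} (hθ : IsTimeChange φ ψ π θ)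
    (hζ : IsTimeChange ψ φ π.symm ζ) {M : ℝ} (hM0 : 0 < M) (hM : ∀ x, θ 1 x ≤ M) :
    topEntropy φ ≤ ENNReal.ofReal M * topEntropy ψ := by
  have : Nonempty Y := Nonempty.map π inferInstance
  refine hζ.topEntropy_le_mul hM0 hM0.le fun x t ht =>
    ⟨θ t x, ⟨?_, ?_⟩, hθ.apply_symm_apply hφ hζ t x⟩
  · rw [← hθ.map_zero x]
    exact (hθ.strictMono x).monotone ht
  · have h1 : θ t x ≤ θ ⌈t⌉₊ x := (hθ.strictMono x).monotone (Nat.le_ceil t)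
    have h2 := hθ.le_nat_mul hM ⌈t⌉₊ x
    have h3 := mul_le_mul_of_nonneg_right (Nat.ceil_lt_add_one ht).le hM0.le
    linarith

end Entropy

theorem exists_eq_ofReal_mul_of_bounds {a b : ℝ≥0∞} {m M : ℝ} (hm : 0 < m)
    (h₁ : ENNReal.ofReal m * b ≤ a) (h₂ : a ≤ ENNReal.ofReal M * b) :
    ∃ C : ℝ, 0 < C ∧ a = ENNReal.ofReal C * b := by
  have hm' : ENNReal.ofReal m ≠ 0 := by simpa using hm
  rcases eq_or_ne b 0 with rfl | hb0
  · exact ⟨1, one_pos, by simpa using h₂⟩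
  rcases eq_or_ne b ⊤ with rfl | hbt
  · rw [ENNReal.mul_top hm'] at h₁
    exact ⟨1, one_pos, by simpa using h₁⟩
  have ha0 : a ≠ 0 := fun h => (mul_ne_zero hm' hb0) (le_zero_iff.1 (h ▸ h₁))
  have hat : a ≠ ⊤ := ne_top_of_le_ne_top (ENNReal.mul_ne_top ENNReal.ofReal_ne_top hbt) h₂
  have hdt : a / b ≠ ⊤ := ENNReal.div_ne_top hat hb0
  refine ⟨(a / b).toReal, ENNReal.toReal_pos (ENNReal.div_ne_zero.2 ⟨ha0, hbt⟩) hdt, ?_⟩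
  rw [ENNReal.ofReal_toReal hdt, ENNReal.div_mul_cancel hb0 hbt]

end FlowEntropy

theorem mainTheorem1 {X Y : Type*} [MetricSpace X] [CompactSpace X] [Nonempty X]
    [MetricSpace Y] [CompactSpace Y] (φ : Flow ℝ X) (ψ : Flow ℝ Y)
    (hφ : FlowEntropy.NoFixedPoints φ) (hψ : FlowEntropy.NoFixedPoints ψ)
    (π : X ≃ₜ Y) (hπ : FlowEntropy.IsWeakEquivalence φ ψ π) :
    (∃! θ : ℝ → X → ℝ, FlowEntropy.IsTimeChange φ ψ π θ) ∧
    (∀ θ : ℝ → X → ℝ, FlowEntropy.IsTimeChange φ ψ π θ →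
      ∃ m M : ℝ, IsLeast (Set.range (θ 1)) m ∧ IsGreatest (Set.range (θ 1)) M ∧ 0 < m ∧ m ≤ M ∧
        ENNReal.ofReal m * FlowEntropy.topEntropy ψ ≤ FlowEntropy.topEntropy φ ∧
        FlowEntropy.topEntropy φ ≤ ENNReal.ofReal M * FlowEntropy.topEntropy ψ) ∧
    (∃ C : ℝ, 0 < C ∧
      FlowEntropy.topEntropy φ = ENNReal.ofReal C * FlowEntropy.topEntropy ψ) ∧
    (FlowEntropy.topEntropy φ = 0 ↔ FlowEntropy.topEntropy ψ = 0) ∧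
    ((0 < FlowEntropy.topEntropy φ ∧ FlowEntropy.topEntropy φ < ⊤) ↔
      (0 < FlowEntropy.topEntropy ψ ∧ FlowEntropy.topEntropy ψ < ⊤)) ∧
    (FlowEntropy.topEntropy φ = ⊤ ↔ FlowEntropy.topEntropy ψ = ⊤) := by
  obtain ⟨θ₀, hθ₀⟩ := hπ.exists_isTimeChange hψ
  obtain ⟨ζ, hζ⟩ := hπ.symm.exists_isTimeChange hφ
  have hbounds : ∀ θ : ℝ → X → ℝ, FlowEntropy.IsTimeChange φ ψ π θ →
      ∃ m M : ℝ, IsLeast (Set.range (θ 1)) m ∧ IsGreatest (Set.range (θ 1)) M ∧ 0 < m ∧ m ≤ M ∧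
        ENNReal.ofReal m * FlowEntropy.topEntropy ψ ≤ FlowEntropy.topEntropy φ ∧
        FlowEntropy.topEntropy φ ≤ ENNReal.ofReal M * FlowEntropy.topEntropy ψ := by
    intro θ hθ
    have hcpt := isCompact_range (hθ.continuous_right 1)
    obtain ⟨m, hm⟩ := hcpt.exists_isLeast (range_nonempty _)
    obtain ⟨M, hM⟩ := hcpt.exists_isGreatest (range_nonempty _)
    have hm0 : 0 < m := by
      obtain ⟨x, rfl⟩ := hm.1
      have := hθ.strictMono x one_pos
      simpa [hθ.map_zero] using this
    have hmM : m ≤ M := hm.2 hM.1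
    exact ⟨m, M, hm, hM, hm0, hmM,
      hθ.ofReal_mul_topEntropy_le hm0 fun x => hm.2 (mem_range_self x),
      hθ.topEntropy_le_ofReal_mul hφ hζ (hm0.trans_le hmM) fun x => hM.2 (mem_range_self x)⟩
  obtain ⟨m, M, -, -, hm0, -, h₁, h₂⟩ := hbounds θ₀ hθ₀
  obtain ⟨C, hC, hCeq⟩ := FlowEntropy.exists_eq_ofReal_mul_of_bounds hm0 h₁ h₂
  have hC' : ENNReal.ofReal C ≠ 0 := by simpa using hC
  have hzero : FlowEntropy.topEntropy φ = 0 ↔ FlowEntropy.topEntropy ψ = 0 := by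
    rw [hCeq, mul_eq_zero, or_iff_right hC']
  have htop : FlowEntropy.topEntropy φ = ⊤ ↔ FlowEntropy.topEntropy ψ = ⊤ := by
    rw [hCeq, ENNReal.mul_eq_top]
    simp [hC]
  refine ⟨⟨θ₀, hθ₀, fun θ hθ => hθ.eq hψ hθ₀⟩, hbounds, ⟨C, hC, hCeq⟩, hzero, ?_, htop⟩
  rw [pos_iff_ne_zero, pos_iff_ne_zero, lt_top_iff_ne_top, lt_top_iff_ne_top, Ne, Ne, Ne, Ne,
    hzero, htop]
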